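/- Let $G$ be a finite simple connected plane graph (vertices are distinct points of the plane; edges are simple arcs joining their two ends, passing through no other vertex and meeting one another only in common ends) in which every vertex has degree at least $3$. The faces of $G$ are the connected components of the complement of $G$ in the plane, including the unbounded one, and a face is called triangular if its boundary is a cycle of length $3$ of $G$. Suppose that no edge of $G$ lies on the boundary of two distinct triangular faces. Then $G$ has finitely many faces and, if $f$ denotes the number of all faces and $f_3$ the number of triangular faces, $$f_3 \le \frac{2f-4}{3};$$ in particular $f_3 < \tfrac{2}{3} f$, i.e. strictly less than two thirds of the faces are triangular. -/

import Mathlib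

/-- `A` is a (simple, Jordan) arc in the plane with endpoints `a` and `b`: the image of `[0,1]`
under a continuous injective map sending `0` to `a` and `1` to `b`. The Euclidean plane is `ℂ`. -/
def IsArc (A : Set ℂ) (a b : ℂ) : Prop :=
  ∃ γ : unitInterval → ℂ, Continuous γ ∧ Function.Injective γ ∧
    γ 0 = a ∧ γ 1 = b ∧ Set.range γ = A

/-- A drawing without crossings of the simple graph `G` in the plane. A plane graph is a graph
together with such a drawing. -/
structure PlaneDrawing {V : Type*} (G : SimpleGraph V) where
  /-- the point that represents a vertex -/
  point : V → ℂ
  /-- the arc (with its endpoints) that represents an edge -/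
  arc : G.edgeSet → Set ℂ
  point_injective : Function.Injective point
  isArc : ∀ (u v : V) (h : G.Adj u v), IsArc (arc ⟨s(u, v), h⟩) (point u) (point v)
  /-- an edge passes through no vertex other than its two ends -/
  mem_of_point_mem_arc : ∀ (e : G.edgeSet) (v : V), point v ∈ arc e → v ∈ (e : Sym2 V)
  /-- two distinct edges meet only in common ends -/
  arc_inter_arc : ∀ e e' : G.edgeSet, e ≠ e' →
    arc e ∩ arc e' ⊆ point '' {v | v ∈ (e : Sym2 V) ∧ v ∈ (e' : Sym2 V)}

namespace PlaneDrawing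

variable {V : Type*} {G : SimpleGraph V}

/-- The point set of the plane graph. -/
def support (D : PlaneDrawing G) : Set ℂ :=
  Set.range D.point ∪ ⋃ e, D.arc e

/-- The faces of the plane graph (the unbounded one included): the connected components of the
complement of its point set. -/
def faces (D : PlaneDrawing G) : Set (Set ℂ) :=
  {F | ∃ x ∈ D.supportᶜ, F = connectedComponentIn D.supportᶜ x}

/-- An edge lies on (the boundary of) `F`. -/
def OnBoundary (D : PlaneDrawing G) (e : G.edgeSet) (F : Set ℂ) : Prop :=
  D.arc e ⊆ frontier F

/-- The boundary of `F` is a triangle (a cycle of length three) of the plane graph. -/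
def BoundedByTriangle (D : PlaneDrawing G) (F : Set ℂ) : Prop :=
  ∃ (u v w : V) (huv : G.Adj u v) (hvw : G.Adj v w) (hwu : G.Adj w u),
    frontier F = D.arc ⟨s(u, v), huv⟩ ∪ D.arc ⟨s(v, w), hvw⟩ ∪ D.arc ⟨s(w, u), hwu⟩

/-- The triangular faces of the plane graph. -/
def triangularFaces (D : PlaneDrawing G) : Set (Set ℂ) :=
  {F | F ∈ D.faces ∧ D.BoundedByTriangle F}

end PlaneDrawing

/-! Write v, e for the numbers of vertices and edges. A triangular face with a corner at a vertex
uses two edges there, and no edge serves two such faces. So t triangular corners at a vertex force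
degree at least 2t. As the degree is also at least 3, it is at least t + 2. Summing over vertices
gives 3 f₃ + 2v ≤ 2e (`three_mul_ncard_triangularFaces_add_le`). Euler's inequality e + 2 ≤ f + v
(`card_edgeSet_add_two_le`) then yields 3 f₃ + 4 ≤ 2f.

The topology rests on continuous logarithms instead of the Jordan curve theorem. Fix a spanning
tree. For each other edge, with ends p and q, the function (z - p) / (z - q) has a logarithm off the
edge and another off the tree. Their difference, divided by 2πi, is an integer on each face. These e
- v + 1 integer functions on the faces, together with the constant 1, are linearly independent by
`eq_zero_of_sum_log_jump`, so f ≥ e - v + 2. Finiteness of f comes from Borsuk's criterion. -/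

open Set Topology

/-! ### Continuous logarithms and winding numbers in the plane -/

namespace PlaneGraph

/-- A continuous map with constant exponential is constant on preconnected sets. -/
theorem eq_of_exp_eqOn {X : Type*} [TopologicalSpace X] {S : Set X} (hS : IsPreconnected S)
    {f : X → ℂ} (hf : ContinuousOn f S) {c : ℂ} (hc : ∀ x ∈ S, Complex.exp (f x) = c)
    {x y : X} (hx : x ∈ S) (hy : y ∈ S) : f x = f y := by
  have : PreconnectedSpace S := Subtype.preconnectedSpace hS
  have h := Complex.isCoveringMap_exp.const_of_comp
    (continuousOn_iff_continuous_domRestrict.1 hf)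
    (fun a b => Subtype.ext ((hc a a.2).trans (hc b b.2).symm))
  exact h ⟨x, hx⟩ ⟨y, hy⟩

/-- A nowhere vanishing homotopy that starts at a map with a logarithm ends at one. -/
theorem exists_log_of_homotopy {X : Type*} [TopologicalSpace X] (H : unitInterval × X → ℂ)
    (hH : Continuous H) (hne : ∀ z, H z ≠ 0) (f : X → ℂ) (hf : Continuous f)
    (h0 : ∀ x, H (0, x) = Complex.exp (f x)) :
    ∃ g : X → ℂ, Continuous g ∧ ∀ x, Complex.exp (g x) = H (1, x) := by
  let H' : C(unitInterval × X, {z : ℂ // z ≠ 0}) :=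
    ⟨fun z => ⟨H z, hne z⟩, hH.subtype_mk _⟩
  let L := Complex.isCoveringMap_exp.liftHomotopy H' ⟨f, hf⟩ (fun x => Subtype.ext (h0 x))
  refine ⟨fun x => L (1, x), by fun_prop, fun x => ?_⟩
  have := congrFun (Complex.isCoveringMap_exp.liftHomotopy_lifts H' ⟨f, hf⟩
    (fun x => Subtype.ext (h0 x))) (1, x)
  exact congrArg Subtype.val this

/-- A nowhere vanishing continuous function on an arc has a continuous logarithm. -/
theorem exists_log_on_arc {A : Set ℂ} {a b : ℂ} (hA : IsArc A a b) {f : ℂ → ℂ}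
    (hf : ContinuousOn f A) (hne : ∀ z ∈ A, f z ≠ 0) :
    ∃ g : ℂ → ℂ, ContinuousOn g A ∧ ∀ z ∈ A, Complex.exp (g z) = f z := by
  obtain ⟨γ, hγ, hinj, -, -, rfl⟩ := hA
  have hfγ : Continuous (f ∘ γ) := hf.comp_continuous hγ (fun t => mem_range_self t)
  obtain ⟨L, hL, hL0⟩ := Complex.isCoveringMap_exp.exists_path_lifts
    ⟨fun t => ⟨f (γ t), hne _ (mem_range_self t)⟩, hfγ.subtype_mk _⟩
    (Complex.log (f (γ 0))) (Subtype.ext (Complex.exp_log (hne _ (mem_range_self 0))).symm)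
  have hemb : IsClosedEmbedding γ := hγ.isClosedEmbedding hinj
  refine ⟨fun z => L (Function.invFun γ z), ?_, ?_⟩
  · rw [continuousOn_iff_continuous_domRestrict]
    have : (range γ).domRestrict (fun z => L (Function.invFun γ z))
        = L ∘ hemb.isEmbedding.toHomeomorph.symm := by
      ext ⟨_, t, rfl⟩
      have h1 : hemb.isEmbedding.toHomeomorph.symm ⟨γ t, mem_range_self t⟩ = t := by
        rw [Homeomorph.symm_apply_eq]; rfl
      simp only [domRestrict_apply, Function.comp_apply, h1, Function.leftInverse_invFun hinj t]
    rw [this]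
    exact L.continuous.comp (Homeomorph.continuous _)
  · rintro _ ⟨t, rfl⟩
    simp only [Function.leftInverse_invFun hinj t]
    exact congrArg Subtype.val (congrFun hL t)

/-- The winding number of `(z - c) ^ n` along a circle about `c` is `n`. -/
theorem eq_zero_of_log_on_sphere {c : ℂ} {r : ℝ} (hr : 0 < r) {n : ℤ} {L : ℂ → ℂ}
    (hL : ContinuousOn L (Metric.sphere c r))
    (hexp : ∀ z ∈ Metric.sphere c r, Complex.exp (L z) = (z - c) ^ n) : n = 0 := by
  have hmem : ∀ θ : ℝ, c + r * Complex.exp (θ * Complex.I) ∈ Metric.sphere c r := fun θ => by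
    simp [Complex.norm_exp_ofReal_mul_I, abs_of_pos hr]
  -- Subtracting n i θ leaves a function whose exponential is the constant r ^ n, so it is itself
  -- constant; comparing θ = 0 with θ = 2π gives 2π i n = 0.
  have hcont : Continuous fun θ : ℝ => L (c + r * Complex.exp (θ * Complex.I))
      - n * (θ * Complex.I) :=
    (hL.comp_continuous (by fun_prop) hmem).sub (by fun_prop)
  have h := eq_of_exp_eqOn (isPreconnected_univ (α := ℝ)) hcont.continuousOn (c := (r : ℂ) ^ n)
    (fun θ _ => by
      rw [Complex.exp_sub, hexp _ (hmem θ), Complex.exp_int_mul]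
      rw [add_sub_cancel_left, mul_zpow, mul_div_assoc,
        div_self (zpow_ne_zero _ (Complex.exp_ne_zero _)), mul_one])
    (mem_univ 0) (mem_univ (2 * Real.pi))
  have h2 : Complex.exp ((2 * Real.pi : ℝ) * Complex.I) = 1 := by
    push_cast; exact Complex.exp_two_pi_mul_I
  rw [h2] at h
  simp only [Complex.ofReal_zero, zero_mul, Complex.exp_zero, mul_zero, sub_zero] at h
  have h3 := sub_eq_self.1 h.symm
  simpa [Real.pi_ne_zero] using h3

/-- A small circle about p does not wind around q: on it (z - q) / (p - q) stays in the slit plane.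
Adding back n times a logarithm of z - q therefore gives a logarithm of (z - p) ^ n on that circle.
-/
theorem eq_zero_of_log_div {p q : ℂ} (hpq : p ≠ q) {n : ℤ} {L : ℂ → ℂ}
    (hL : ContinuousOn L {p, q}ᶜ)
    (hexp : ∀ z ∈ ({p, q}ᶜ : Set ℂ), Complex.exp (L z) = ((z - p) / (z - q)) ^ n) : n = 0 := by
  have hd : 0 < ‖p - q‖ := norm_pos_iff.2 (sub_ne_zero.2 hpq)
  have hr : 0 < ‖p - q‖ / 2 := by positivity
  have hz : ∀ z ∈ Metric.sphere p (‖p - q‖ / 2), z ∈ ({p, q}ᶜ : Set ℂ) := by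
    intro z hz
    rw [mem_sphere_iff_norm] at hz
    simp only [mem_compl_iff, mem_insert_iff, mem_singleton_iff, not_or]
    constructor
    · rintro rfl; simp at hz; linarith
    · rintro rfl; rw [norm_sub_rev] at hz; linarith
  have hs : ∀ z ∈ Metric.sphere p (‖p - q‖ / 2), (z - q) / (p - q) ∈ Complex.slitPlane := by
    intro z hz
    have h1 : (z - q) / (p - q) = 1 + (z - p) / (p - q) := by
      have := sub_ne_zero.2 hpq
      field_simp; ring
    rw [h1]
    apply Complex.mem_slitPlane_of_norm_lt_one
    rw [mem_sphere_iff_norm] at hz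
    rw [norm_div, hz]
    rw [div_lt_one hd]; linarith
  refine eq_zero_of_log_on_sphere (c := p) hr
    (L := fun z => L z + n * (Complex.log (p - q) + Complex.log ((z - q) / (p - q)))) ?_ ?_
  · refine (hL.mono hz).add (continuousOn_const.mul (continuousOn_const.add ?_))
    exact ContinuousOn.clog (by fun_prop) hs
  · intro z h
    have h0 := sub_ne_zero.2 hpq
    have h1 := Complex.slitPlane_ne_zero (hs z h)
    have h2 : z - q ≠ 0 := fun h => h1 (by simp [h])
    rw [Complex.exp_add, hexp z (hz z h), Complex.exp_int_mul, Complex.exp_add,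
      Complex.exp_log h0, Complex.exp_log h1, ← mul_zpow]
    congr 1
    field_simp

/-- If a closed set contains a path from `p` to `q`, then `(z - p) / (z - q)` has a
continuous logarithm off that set. -/
theorem exists_log_div_of_joinedIn {K : Set ℂ} {p q : ℂ} (h : JoinedIn K p q) :
    ∃ L : ℂ → ℂ, ContinuousOn L Kᶜ ∧ ∀ z ∈ Kᶜ, Complex.exp (L z) = (z - p) / (z - q) := by
  obtain ⟨γ, hγ⟩ := h.symm
  have hne : ∀ (z : ↥Kᶜ) (t : unitInterval), (z : ℂ) - γ t ≠ 0 := fun z t h0 =>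
    z.2 (by rw [sub_eq_zero.1 h0]; exact hγ t)
  have hq : ∀ z : ↥Kᶜ, (z : ℂ) - q ≠ 0 := fun z => by simpa using hne z 0
  -- The zero of the numerator slides along the path from q to p. At time 0 the quotient is 1, with
  -- logarithm 0.
  obtain ⟨g, hg, hexp⟩ := exists_log_of_homotopy (X := ↥Kᶜ)
    (fun x => ((x.2 : ℂ) - γ x.1) / ((x.2 : ℂ) - q))
    (Continuous.div (by fun_prop) (by fun_prop) fun x => hq x.2)
    (fun x => div_ne_zero (hne _ _) (hq _)) (fun _ => 0) continuous_const
    (fun x => by simp [div_self (hq x)])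
  classical
  refine ⟨fun z => if hz : z ∈ Kᶜ then g ⟨z, hz⟩ else 0, ?_, fun z hz => ?_⟩
  · rw [continuousOn_iff_continuous_domRestrict]
    convert hg using 1
    ext ⟨z, hz⟩
    have hz' : z ∉ K := hz
    simp [hz']
  · have := hexp ⟨z, hz⟩
    simp only [hz, dite_true, this, γ.target]

theorem exists_continuousOn_glue {X Y : Type*} [TopologicalSpace X] [TopologicalSpace Y]
    {U V : Set X} (hU : IsOpen U) (hV : IsOpen V) {f g : X → Y} (hf : ContinuousOn f U)
    (hg : ContinuousOn g V) (hfg : EqOn f g (U ∩ V)) :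
    ∃ h : X → Y, ContinuousOn h (U ∪ V) ∧ EqOn h f U ∧ EqOn h g V := by
  classical
  have h1 : EqOn (U.piecewise f g) f U := fun x hx => by simp [hx]
  have h2 : EqOn (U.piecewise f g) g V := fun x hx => by
    by_cases hxU : x ∈ U
    · simp [hxU, hfg ⟨hxU, hx⟩]
    · simp [hxU]
  exact ⟨U.piecewise f g, ContinuousOn.union_of_isOpen (hf.congr h1) (hg.congr h2) hU hV, h1, h2⟩

theorem exp_two_pi_I_mul_int (k : ℤ) : Complex.exp (2 * Real.pi * Complex.I * k) = 1 :=
  Complex.exp_eq_one_iff.2 ⟨k, by ring⟩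

theorem exists_int_of_exp_eq {a b : ℂ} (h : Complex.exp a = Complex.exp b) :
    ∃ k : ℤ, a - b = 2 * Real.pi * Complex.I * k := by
  obtain ⟨k, hk⟩ := Complex.exp_eq_exp_iff_exists_int.1 h
  exact ⟨k, by rw [hk]; ring⟩

/-- Borsuk's criterion: a point of a bounded component cannot be unwound on the boundary. -/
theorem eq_zero_of_log_on_frontier {K U : Set ℂ} (hK : IsClosed K) (hU : IsOpen U)
    (hb : Bornology.IsBounded U) (hfr : frontier U ⊆ K) {a : ℂ} (ha : a ∈ U) {n : ℤ}
    {g h : ℂ → ℂ} (hg : ContinuousOn g K) (hh : ContinuousOn h (closure U))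
    (hne : ∀ z ∈ closure U, h z ≠ 0)
    (hexp : ∀ z ∈ K, Complex.exp (g z) = (z - a) ^ n * h z) : n = 0 := by
  classical
  -- Tietze extends g from K to the whole plane.
  obtain ⟨G, hG⟩ := ContinuousMap.exists_restrict_eq hK
    ⟨K.domRestrict g, continuousOn_iff_continuous_domRestrict.1 hg⟩
  have hG' : ∀ z ∈ K, G z = g z := fun z hz => congrArg (fun f => f ⟨z, hz⟩) hG
  have hza : ∀ z ∉ U, z - a ≠ 0 := fun z hz h0 => hz (by rw [sub_eq_zero.1 h0]; exact ha)
  -- The two formulas agree on the frontier of U, so H is continuous and nowhere zero on the simply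
  -- connected plane and has a logarithm. On a large circle this is a logarithm of (z - a) ^ n.
  let H : ℂ → ℂ := (closure U).piecewise (fun z => Complex.exp (G z) / h z)
    (fun z => (z - a) ^ n)
  have hcl : closure (closure U)ᶜ ⊆ Uᶜ :=
    closure_minimal (compl_subset_compl.2 subset_closure) hU.isClosed_compl
  have hHc : Continuous H := by
    refine continuous_piecewise ?_ ?_ ?_
    · intro z hz
      have hz1 : z ∈ frontier U := frontier_closure_subset hz
      have hzU : z ∉ U := by
        rw [hU.frontier_eq] at hz1; exact hz1.2
      rw [hG' z (hfr hz1), hexp z (hfr hz1), mul_div_cancel_right₀]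
      exact hne z (frontier_subset_closure hz1)
    · rw [closure_closure]
      exact (by fun_prop : Continuous fun z => Complex.exp (G z)).continuousOn.div hh hne
    · intro z hz
      exact (((continuous_id.sub continuous_const).continuousAt).zpow₀ n
        (Or.inl (hza z (hcl hz)))).continuousWithinAt
  have hH0 : ∀ z, H z ≠ 0 := fun z => by
    by_cases hz : z ∈ closure U
    · simp only [H, hz, piecewise_eq_of_mem]
      exact div_ne_zero (Complex.exp_ne_zero _) (hne z hz)
    · simp only [H, hz, not_false_eq_true, piecewise_eq_of_notMem]
      exact zpow_ne_zero _ (hza z fun h => hz (subset_closure h))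
  obtain ⟨L, ⟨-, hL⟩, -⟩ := Complex.isCoveringMap_exp.existsUnique_continuousMap_lifts
    (A := ℂ) ⟨fun z => ⟨H z, hH0 z⟩, hHc.subtype_mk _⟩ 0 (Complex.log (H 0))
    (Subtype.ext (Complex.exp_log (hH0 0)))
  obtain ⟨r, hr⟩ := hb.closure.subset_closedBall a
  refine eq_zero_of_log_on_sphere (c := a) (r := max r 0 + 1) (by positivity)
    L.continuous.continuousOn fun z hz => ?_
  have h1 : Complex.exp (L z) = H z := congrArg Subtype.val (congrFun hL z)
  have hz' : z ∉ closure U := fun h => by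
    have h2 := hr h
    rw [Metric.mem_closedBall] at h2
    rw [Metric.mem_sphere] at hz
    have := le_max_left r 0
    linarith
  rw [h1]
  simp only [H, hz', not_false_eq_true, piecewise_eq_of_notMem]

end PlaneGraph

/-! ### Faces of a plane drawing and their finiteness -/

theorem IsArc.isCompact {A : Set ℂ} {a b : ℂ} (h : IsArc A a b) : IsCompact A := by
  obtain ⟨γ, hγ, -, -, -, rfl⟩ := h
  exact isCompact_range hγ

theorem IsArc.joinedIn {A : Set ℂ} {a b : ℂ} (h : IsArc A a b) : JoinedIn A a b := by
  obtain ⟨γ, hγ, -, h0, h1, rfl⟩ := h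
  exact ⟨⟨⟨γ, hγ⟩, h0, h1⟩, fun t => mem_range_self t⟩

namespace PlaneDrawing

variable {V : Type*} {G : SimpleGraph V} (D : PlaneDrawing G)

theorem exists_isArc (e : G.edgeSet) :
    ∃ u v : V, G.Adj u v ∧ (e : Sym2 V) = s(u, v) ∧ IsArc (D.arc e) (D.point u) (D.point v) := by
  obtain ⟨e, he⟩ := e
  induction e using Sym2.ind with
  | _ u v => exact ⟨u, v, he, rfl, D.isArc u v he⟩

theorem isCompact_arc (e : G.edgeSet) : IsCompact (D.arc e) :=
  let ⟨_, _, _, _, h⟩ := D.exists_isArc e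
  h.isCompact

theorem point_mem_arc {e : G.edgeSet} {v : V} (hv : v ∈ (e : Sym2 V)) :
    D.point v ∈ D.arc e := by
  obtain ⟨u, w, -, he, h⟩ := D.exists_isArc e
  rw [he, Sym2.mem_iff] at hv
  rcases hv with rfl | rfl
  exacts [h.joinedIn.source_mem, h.joinedIn.target_mem]

theorem arc_subset_support (e : G.edgeSet) : D.arc e ⊆ D.support :=
  fun _ hz => Or.inr (mem_iUnion.2 ⟨e, hz⟩)

theorem isCompact_support [Finite V] : IsCompact D.support :=
  (finite_range D.point).isCompact.union (isCompact_iUnion D.isCompact_arc)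

section Faces

variable {D} {F F' : Set ℂ}

theorem nonempty_of_mem_faces (hF : F ∈ D.faces) : F.Nonempty := by
  obtain ⟨x, hx, rfl⟩ := hF
  exact ⟨x, mem_connectedComponentIn hx⟩

theorem isPreconnected_of_mem_faces (hF : F ∈ D.faces) : IsPreconnected F := by
  obtain ⟨x, hx, rfl⟩ := hF
  exact isPreconnected_connectedComponentIn

theorem subset_compl_of_mem_faces (hF : F ∈ D.faces) : F ⊆ D.supportᶜ := by
  obtain ⟨x, hx, rfl⟩ := hF
  exact connectedComponentIn_subset _ _

theorem eq_connectedComponentIn_of_mem (hF : F ∈ D.faces) {x : ℂ} (hx : x ∈ F) :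
    F = connectedComponentIn D.supportᶜ x := by
  obtain ⟨y, hy, rfl⟩ := hF
  exact connectedComponentIn_eq hx

theorem eq_of_mem_faces (hF : F ∈ D.faces) (hF' : F' ∈ D.faces) {x : ℂ} (hx : x ∈ F)
    (hx' : x ∈ F') : F = F' :=
  (eq_connectedComponentIn_of_mem hF hx).trans (eq_connectedComponentIn_of_mem hF' hx').symm

variable [Finite V]

theorem isOpen_of_mem_faces (hF : F ∈ D.faces) : IsOpen F := by
  obtain ⟨x, hx, rfl⟩ := hF
  exact D.isCompact_support.isClosed.isOpen_compl.connectedComponentIn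

theorem frontier_subset_of_mem_faces (hF : F ∈ D.faces) : frontier F ⊆ D.support := by
  intro z hz
  by_contra hzs
  have hF' : connectedComponentIn D.supportᶜ z ∈ D.faces := ⟨z, hzs, rfl⟩
  have hzF' := mem_connectedComponentIn (F := D.supportᶜ) hzs
  obtain ⟨y, hy, hyF⟩ := mem_closure_iff.1 (frontier_subset_closure hz) _
    (isOpen_of_mem_faces hF') hzF'
  rw [(isOpen_of_mem_faces hF).frontier_eq] at hz
  exact hz.2 (eq_of_mem_faces hF hF' hyF hy ▸ hzF')

/-- The exterior of a disc containing the support is connected, being the image of a half-plane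
under exp, so every unbounded face contains it. -/
theorem unbounded_faces_subsingleton :
    {F ∈ D.faces | ¬ Bornology.IsBounded F}.Subsingleton := by
  obtain ⟨r, hr0, hr⟩ := D.isCompact_support.isBounded.subset_closedBall_lt 0 0
  have hfar : IsPreconnected (Metric.closedBall (0 : ℂ) r)ᶜ := by
    have himg : (Metric.closedBall (0 : ℂ) r)ᶜ = Complex.exp '' {z | Real.log r < z.re} := by
      ext z
      simp only [mem_compl_iff, mem_closedBall_zero_iff, not_le, mem_image, mem_ofPred_eq]
      constructor
      · intro hz
        have h0 : z ≠ 0 := norm_pos_iff.1 (hr0.trans hz)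
        exact ⟨Complex.log z, by rw [Complex.log_re]; exact Real.log_lt_log hr0 hz,
          Complex.exp_log h0⟩
      · rintro ⟨w, hw, rfl⟩
        rw [Complex.norm_exp]
        exact (Real.log_lt_iff_lt_exp hr0).1 hw
    rw [himg]
    exact (convex_halfSpace_re_gt _).isPreconnected.image _ Complex.continuous_exp.continuousOn
  have key : ∀ F ∈ D.faces, ¬ Bornology.IsBounded F → (Metric.closedBall (0 : ℂ) r)ᶜ ⊆ F := by
    intro F hF hb
    have : ¬ F ⊆ Metric.closedBall 0 r := fun h => hb (Metric.isBounded_closedBall.subset h)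
    obtain ⟨x, hx, hxr⟩ := not_subset.1 this
    rw [eq_connectedComponentIn_of_mem hF hx]
    exact hfar.subset_connectedComponentIn hxr (compl_subset_compl.2 hr)
  rintro F ⟨hF, hb⟩ F' ⟨hF', hb'⟩
  have : ¬ F ⊆ Metric.closedBall 0 r := fun h => hb (Metric.isBounded_closedBall.subset h)
  obtain ⟨x, hx, hxr⟩ := not_subset.1 this
  exact eq_of_mem_faces hF hF' hx (key F' hF' hb' hxr)

/-- Too many nonzero functions on the support are multiplicatively dependent modulo exponentials. -/
theorem exists_log_prod_zpow {ι : Type*} [Fintype ι] [Fintype V] [Fintype G.edgeSet]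
    (hι : Fintype.card (G.edgeSet × V) < Fintype.card ι) (f : ι → ℂ → ℂ)
    (hf : ∀ i, ContinuousOn (f i) D.support) (hne : ∀ i, ∀ z ∈ D.support, f i z ≠ 0) :
    ∃ n : ι → ℤ, n ≠ 0 ∧ ∃ g : ℂ → ℂ, ContinuousOn g D.support ∧
      ∀ z ∈ D.support, Complex.exp (g z) = ∏ i, f i z ^ n i := by
  classical
  have hlog : ∀ (i : ι) (e : G.edgeSet), ∃ g : ℂ → ℂ, ContinuousOn g (D.arc e) ∧
      ∀ z ∈ D.arc e, Complex.exp (g z) = f i z := fun i e => by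
    obtain ⟨u, v, -, -, h⟩ := D.exists_isArc e
    exact PlaneGraph.exists_log_on_arc h ((hf i).mono (D.arc_subset_support e))
      fun z hz => hne i z (D.arc_subset_support e hz)
  choose g hg hexp using hlog
  -- At each end of an edge, the chosen logarithm differs from the principal one by an integer
  -- multiple of 2πi; pairs that are not incident get the value 0.
  have hint : ∀ (i : ι) (p : G.edgeSet × V), ∃ k : ℤ, p.2 ∈ (p.1 : Sym2 V) →
      g i p.1 (D.point p.2) - Complex.log (f i (D.point p.2)) = 2 * Real.pi * Complex.I * k := by
    rintro i ⟨e, v⟩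
    by_cases hv : v ∈ (e : Sym2 V)
    · have h0 : f i (D.point v) ≠ 0 := hne i _ (Or.inl ⟨v, rfl⟩)
      obtain ⟨k, hk⟩ := PlaneGraph.exists_int_of_exp_eq
        ((hexp i e _ (D.point_mem_arc hv)).trans (Complex.exp_log h0).symm)
      exact ⟨k, fun _ => hk⟩
    · exact ⟨0, fun h => absurd h hv⟩
  choose k hk using hint
  -- More integer vectors than coordinates: a relation n kills all discrepancies, so the combined
  -- edge logarithms agree at the vertices.
  have hdep : ¬ LinearIndependent ℤ k := fun h => by
    have := h.fintype_card_le_finrank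
    rw [Module.finrank_fintype_fun_eq_card] at this
    omega
  rw [Fintype.not_linearIndependent_iff] at hdep
  obtain ⟨n, hsum, i₀, hi₀⟩ := hdep
  refine ⟨n, fun h => hi₀ (congrFun h i₀), ?_⟩
  have hvert : ∀ (e : G.edgeSet) (v : V), v ∈ (e : Sym2 V) →
      ∑ i, n i * g i e (D.point v) = ∑ i, n i * Complex.log (f i (D.point v)) := by
    intro e v hv
    have h1 : ∑ i, n i * k i (e, v) = 0 := by
      simpa using congrFun hsum (e, v)
    rw [← sub_eq_zero, ← Finset.sum_sub_distrib]
    have h2 : ∀ i, (n i : ℂ) * g i e (D.point v) - n i * Complex.log (f i (D.point v))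
        = 2 * Real.pi * Complex.I * ((n i * k i (e, v) : ℤ) : ℂ) := fun i => by
      rw [← mul_sub, hk i (e, v) hv]; push_cast; ring
    rw [Finset.sum_congr rfl fun i _ => h2 i, ← Finset.mul_sum, ← Int.cast_sum, h1]
    simp
  -- The choice of edge is immaterial, since two edges share only vertices; the default branch
  -- serves isolated vertices.
  let Φ : ℂ → ℂ := fun z => if h : ∃ e, z ∈ D.arc e then ∑ i, n i * g i h.choose z
    else ∑ i, n i * Complex.log (f i z)
  have hΦ : ∀ e, ∀ z ∈ D.arc e, Φ z = ∑ i, n i * g i e z := by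
    intro e z hz
    have h : ∃ e, z ∈ D.arc e := ⟨e, hz⟩
    simp only [Φ, h, dite_true]
    by_cases he : h.choose = e
    · rw [he]
    · obtain ⟨v, ⟨hv, hv'⟩, rfl⟩ := D.arc_inter_arc _ _ he ⟨h.choose_spec, hz⟩
      rw [hvert _ _ hv, hvert _ _ hv']
  have hsupp : D.support = ⋃ x : V ⊕ G.edgeSet, Sum.elim (fun v => {D.point v}) D.arc x := by
    rw [iUnion_sum]
    simp [support, ← iUnion_singleton_eq_range]
  refine ⟨Φ, ?_, ?_⟩
  · rw [hsupp]
    refine (locallyFinite_of_finite _).continuousOn_iUnion ?_ ?_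
    · rintro (v | e)
      exacts [isClosed_singleton, (D.isCompact_arc e).isClosed]
    · rintro (v | e)
      · exact continuousOn_singleton _ _
      · exact (continuousOn_finsetSum _ fun i _ => continuousOn_const.mul (hg i e)).congr
          (hΦ e)
  · intro z hz
    by_cases h : ∃ e, z ∈ D.arc e
    · obtain ⟨e, he⟩ := h
      rw [hΦ e z he, Complex.exp_sum]
      exact Finset.prod_congr rfl fun i _ => by rw [Complex.exp_int_mul, hexp i e z he]
    · simp only [Φ, h, dite_false, Complex.exp_sum]
      exact Finset.prod_congr rfl fun i _ => by
        rw [Complex.exp_int_mul, Complex.exp_log (hne i z hz)]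

/-- Given too many bounded faces, pick a point a in each. Some nontrivial product of powers of the
functions z - a has a logarithm on the support. On the closure of a face with nonzero exponent the
other factors do not vanish, which contradicts Borsuk's criterion. -/
theorem finite_faces (D : PlaneDrawing G) : D.faces.Finite := by
  classical
  have := Fintype.ofFinite V
  have := Fintype.ofFinite G.edgeSet
  have hbdd : {F ∈ D.faces | Bornology.IsBounded F}.Finite := by
    by_contra hinf
    obtain ⟨t, ht, hcard⟩ := Set.Infinite.exists_subset_card_eq hinf
      (Fintype.card (G.edgeSet × V) + 1)
    have hface : ∀ F : t, (F : Set ℂ) ∈ D.faces := fun F => (ht F.2).1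
    choose a ha using fun F : t => nonempty_of_mem_faces (hface F)
    have hne : ∀ (F : t), ∀ z ∈ D.support, z - a F ≠ 0 := fun F z hz h0 =>
      subset_compl_of_mem_faces (hface F) (ha F) (sub_eq_zero.1 h0 ▸ hz)
    obtain ⟨n, hn, g, hg, hexp⟩ := exists_log_prod_zpow (D := D) (ι := t)
      (by rw [Fintype.card_coe, hcard]; omega) (fun F z => z - a F)
      (fun F => by fun_prop) hne
    obtain ⟨F, hF⟩ := Function.ne_iff.1 hn
    have hcl : ∀ z ∈ closure (F : Set ℂ), ∀ F' ∈ Finset.univ.erase F, z - a F' ≠ 0 := by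
      intro z hz F' hF' h0
      rw [closure_eq_self_union_frontier] at hz
      rcases hz with hz | hz
      · exact Finset.ne_of_mem_erase hF' (Subtype.ext
          (eq_of_mem_faces (hface F') (hface F) (ha F') (sub_eq_zero.1 h0 ▸ hz)))
      · exact hne F' z (frontier_subset_of_mem_faces (hface F) hz) h0
    refine hF (PlaneGraph.eq_zero_of_log_on_frontier D.isCompact_support.isClosed
      (isOpen_of_mem_faces (hface F)) (ht F.2).2 (frontier_subset_of_mem_faces (hface F)) (ha F)
      hg (h := fun z => ∏ F' ∈ Finset.univ.erase F, (z - a F') ^ n F') ?_ ?_ ?_)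
    · refine continuousOn_finsetProd _ fun F' hF' => ?_
      exact ContinuousOn.zpow₀ (by fun_prop) _ fun z hz => Or.inl (hcl z hz F' hF')
    · exact fun z hz => Finset.prod_ne_zero_iff.2 fun F' hF' => zpow_ne_zero _ (hcl z hz F' hF')
    · intro z hz
      rw [hexp z hz, Finset.mul_prod_erase _ (fun i => (z - a i) ^ n i) (Finset.mem_univ F)]
  refine (hbdd.union (unbounded_faces_subsingleton (D := D)).finite).subset fun F hF => ?_
  by_cases hb : Bornology.IsBounded F
  exacts [Or.inl ⟨hF, hb⟩, Or.inr ⟨hF, hb⟩]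

end Faces

end PlaneDrawing

/-! ### Independence of logarithm jumps and Euler's inequality -/

namespace PlaneGraph

/-- Let `(A i)` be closed sets joining `p i` to `q i`, let `T` be a closed set joining the same
pairs, and suppose these sets meet only at end points. If logarithms of `(z - p i) / (z - q i)`
off `T` and off `A i` differ by integers `c i` whose combination with coefficients `n i` is
constant, then all coefficients vanish. -/
theorem eq_zero_of_sum_log_jump {ι : Type*} [Fintype ι] {A : ι → Set ℂ} {T : Set ℂ}
    {p q : ι → ℂ} (hA : ∀ i, IsClosed (A i)) (hT : IsClosed T) (hpq : ∀ i, p i ≠ q i)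
    (hAT : ∀ i, A i ∩ T ⊆ {p i, q i}) (hAA : ∀ i j, i ≠ j → A i ∩ A j ⊆ {p i, q i})
    {a b : ι → ℂ → ℂ} (ha : ∀ i, ContinuousOn (a i) (A i)ᶜ) (hb : ∀ i, ContinuousOn (b i) Tᶜ)
    (hexpa : ∀ i, ∀ z ∈ (A i)ᶜ, Complex.exp (a i z) = (z - p i) / (z - q i))
    (hexpb : ∀ i, ∀ z ∈ Tᶜ, Complex.exp (b i z) = (z - p i) / (z - q i))
    {n : ι → ℤ} {C : ℤ}
    (hC : ∀ z ∈ (T ∪ ⋃ i, A i)ᶜ, ∑ i, n i * (b i z - a i z) = 2 * Real.pi * Complex.I * C)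
    (i : ι) : n i = 0 := by
  classical
  let B : Set ℂ := T ∪ ⋃ j ∈ Finset.univ.erase i, A j
  have hB : IsClosed B := hT.union (isClosed_biUnion_finset fun j _ => hA j)
  have hBT : Bᶜ ⊆ Tᶜ := compl_subset_compl.2 subset_union_left
  have hBA : ∀ j ∈ Finset.univ.erase i, Bᶜ ⊆ (A j)ᶜ := fun j hj =>
    compl_subset_compl.2 ((subset_biUnion_of_mem (u := fun j => A j)
      (Finset.mem_coe.2 hj)).trans subset_union_right)
  -- By `hC`, f equals n i * a i off all the sets, and it is continuous across A i away from the end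
  -- points. Gluing gives a logarithm of ((z - p i) / (z - q i)) ^ n i off the two points, which
  -- `eq_zero_of_log_div` forbids unless n i = 0.
  let f : ℂ → ℂ := fun z => ∑ j, n j * b j z - 2 * Real.pi * Complex.I * C
    - ∑ j ∈ Finset.univ.erase i, n j * a j z
  have hf : ContinuousOn f Bᶜ :=
    ((continuousOn_finsetSum _ fun j _ => continuousOn_const.mul ((hb j).mono hBT)).sub
      continuousOn_const).sub
      (continuousOn_finsetSum _ fun j hj => continuousOn_const.mul ((ha j).mono (hBA j hj)))
  obtain ⟨L, hL, hLa, hLf⟩ := exists_continuousOn_glue (hA i).isOpen_compl hB.isOpen_compl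
    (f := fun z => n i * a i z) (continuousOn_const.mul (ha i)) hf (by
      rintro z ⟨hzA, hzB⟩
      have hz : z ∈ (T ∪ ⋃ i, A i)ᶜ := by
        rintro (h | h)
        · exact hBT hzB h
        · obtain ⟨j, hj⟩ := mem_iUnion.1 h
          by_cases hji : j = i
          · exact hzA (hji ▸ hj)
          · exact hBA j (by simp [hji]) hzB hj
      have h1 := hC z hz
      have h2 := Finset.add_sum_erase Finset.univ (fun j => (n j : ℂ) * a j z)
        (Finset.mem_univ i)
      simp only [mul_sub, Finset.sum_sub_distrib] at h1
      simp only [f]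
      linear_combination h2 - h1)
  have hcover : ({p i, q i}ᶜ : Set ℂ) ⊆ (A i)ᶜ ∪ Bᶜ := by
    intro z hz
    by_contra h
    rw [← compl_inter, notMem_compl_iff] at h
    obtain ⟨hzA, hzT | hzA'⟩ := h
    · exact hz (hAT i ⟨hzA, hzT⟩)
    · obtain ⟨j, hj, hzj⟩ := mem_iUnion₂.1 hzA'
      exact hz (hAA i j (Finset.ne_of_mem_erase hj).symm ⟨hzA, hzj⟩)
  refine eq_zero_of_log_div (hpq i) (hL.mono hcover) fun z hz => ?_
  rcases hcover hz with hzA | hzB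
  · rw [hLa hzA]
    simp only [Complex.exp_int_mul, hexpa i z hzA]
  · rw [hLf hzB]
    simp only [f, Complex.exp_sub, Complex.exp_sum, Complex.exp_int_mul, exp_two_pi_I_mul_int,
      div_one]
    have h1 : ∀ j ∈ Finset.univ.erase i, Complex.exp (a j z) ^ n j
        = ((z - p j) / (z - q j)) ^ n j := fun j hj => by rw [hexpa j z (hBA j hj hzB)]
    have h2 : ∀ j ∈ Finset.univ, Complex.exp (b j z) ^ n j
        = ((z - p j) / (z - q j)) ^ n j := fun j _ => by rw [hexpb j z (hBT hzB)]
    rw [Finset.prod_congr rfl h1, Finset.prod_congr rfl h2,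
      ← Finset.mul_prod_erase _ _ (Finset.mem_univ i), mul_div_assoc, div_self, mul_one]
    refine Finset.prod_ne_zero_iff.2 fun j hj => zpow_ne_zero _ ?_
    rw [← hexpa j z (hBA j hj hzB)]
    exact Complex.exp_ne_zero _

end PlaneGraph

namespace PlaneDrawing

variable {V : Type*} {G : SimpleGraph V} (D : PlaneDrawing G)

/-- The point set of a spanning subgraph. -/
def partialSupport (T : SimpleGraph V) : Set ℂ :=
  range D.point ∪ ⋃ e : {e : G.edgeSet // (e : Sym2 V) ∈ T.edgeSet}, D.arc e

theorem isClosed_partialSupport [Finite V] (T : SimpleGraph V) :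
    IsClosed (D.partialSupport T) :=
  (finite_range D.point).isClosed.union
    (isClosed_iUnion_of_finite fun e => (D.isCompact_arc e).isClosed)

theorem joinedIn_partialSupport {T : SimpleGraph V} (hT : T ≤ G) {u v : V}
    (h : T.Reachable u v) : JoinedIn (D.partialSupport T) (D.point u) (D.point v) := by
  obtain ⟨w⟩ := h
  induction w with
  | nil => exact JoinedIn.refl (Or.inl ⟨_, rfl⟩)
  | @cons x y _ hadj _ ih =>
    have hmem : s(x, y) ∈ T.edgeSet := hadj
    exact ((D.isArc _ _ (hT hadj)).joinedIn.mono (subset_union_of_subset_right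
      (subset_iUnion (fun e : {e : G.edgeSet // (e : Sym2 V) ∈ T.edgeSet} => D.arc e)
        ⟨⟨s(x, y), hT hadj⟩, hmem⟩) _)).trans ih

/-- The inequality of Euler's formula that asserts the existence of many faces. -/
theorem card_edgeSet_add_two_le [Finite V] (hconn : G.Connected) :
    Nat.card G.edgeSet + 2 ≤ D.faces.ncard + Nat.card V := by
  classical
  have := Fintype.ofFinite V
  have := Fintype.ofFinite G.edgeSet
  have : Fintype D.faces := (finite_faces D).fintype
  obtain ⟨T, hTG, hT⟩ := hconn.exists_isTree_le
  let ι := {e : G.edgeSet // (e : Sym2 V) ∉ T.edgeSet}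
  have hends : ∀ e : ι, ∃ u v : V, G.Adj u v ∧ (e.1 : Sym2 V) = s(u, v) ∧
      IsArc (D.arc e.1) (D.point u) (D.point v) := fun e => D.exists_isArc e.1
  choose u v hadj huv harc using hends
  have hla := fun e : ι => PlaneGraph.exists_log_div_of_joinedIn (harc e).joinedIn
  have hlb := fun e : ι => PlaneGraph.exists_log_div_of_joinedIn
    (D.joinedIn_partialSupport hTG (hT.connected.preconnected (u e) (v e)))
  choose a ha hexpa using hla
  choose b hb hexpb using hlb
  have hcompl : D.supportᶜ = (D.partialSupport T ∪ ⋃ e : ι, D.arc e.1)ᶜ := by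
    congr 1
    ext z
    simp only [support, partialSupport, mem_union, mem_iUnion]
    constructor
    · rintro (h | ⟨e, he⟩)
      · exact Or.inl (Or.inl h)
      · by_cases heT : (e : Sym2 V) ∈ T.edgeSet
        exacts [Or.inl (Or.inr ⟨⟨e, heT⟩, he⟩), Or.inr ⟨⟨e, heT⟩, he⟩]
    · rintro ((h | ⟨e, he⟩) | ⟨e, he⟩)
      exacts [Or.inl h, Or.inr ⟨_, he⟩, Or.inr ⟨_, he⟩]
  have hsubA : ∀ e : ι, D.supportᶜ ⊆ (D.arc e.1)ᶜ := fun e =>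
    compl_subset_compl.2 (D.arc_subset_support e.1)
  have hsubT : D.supportᶜ ⊆ (D.partialSupport T)ᶜ := by
    rw [hcompl]; exact compl_subset_compl.2 subset_union_left
  choose x hx using fun F : D.faces => nonempty_of_mem_faces F.2
  have hxs : ∀ F, x F ∈ D.supportᶜ := fun F => subset_compl_of_mem_faces F.2 (hx F)
  have hint : ∀ (e : ι) (F : D.faces), ∃ k : ℤ,
      b e (x F) - a e (x F) = 2 * Real.pi * Complex.I * k := fun e F =>
    PlaneGraph.exists_int_of_exp_eq (by
      rw [hexpa e _ (hsubA e (hxs F)), hexpb e _ (hsubT (hxs F))])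
  choose k hk using hint
  have hconst : ∀ (e : ι) (F : D.faces), ∀ z ∈ (F : Set ℂ),
      b e z - a e z = 2 * Real.pi * Complex.I * k e F := by
    intro e F z hz
    rw [← hk]
    have hF := subset_compl_of_mem_faces F.2
    refine PlaneGraph.eq_of_exp_eqOn (isPreconnected_of_mem_faces F.2)
      (f := fun z => b e z - a e z) (c := 1)
      (((hb e).mono (hF.trans hsubT)).sub ((ha e).mono (hF.trans (hsubA e)))) ?_ hz (hx F)
    intro y hy
    rw [Complex.exp_sub, hexpb e y (hsubT (hF hy)), hexpa e y (hsubA e (hF hy)), div_self]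
    rw [← hexpa e y (hsubA e (hF hy))]
    exact Complex.exp_ne_zero _
  have hend : ∀ (e : ι) (w : V), w ∈ (e.1 : Sym2 V) → D.point w ∈
      ({D.point (u e), D.point (v e)} : Set ℂ) := by
    intro e w hw
    rw [huv e, Sym2.mem_iff] at hw
    rcases hw with rfl | rfl <;> simp
  have hmeet : ∀ (e : ι) (e' : G.edgeSet), e.1 ≠ e' → D.arc e.1 ∩ D.arc e' ⊆
      {D.point (u e), D.point (v e)} := by
    intro e e' hne z hz
    obtain ⟨w, ⟨hw, -⟩, rfl⟩ := D.arc_inter_arc _ _ hne hz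
    exact hend e w hw
  -- The value `none` stands for the constant function 1; it accounts for the second unit of the 2
  -- in Euler's formula, the first coming from the edge count v - 1 of the tree.
  have hlin : LinearIndependent ℤ (fun o : Option ι => o.elim (1 : D.faces → ℤ) k) := by
    rw [Fintype.linearIndependent_iff]
    intro m hm
    have hm' : ∀ F, m none + ∑ e, m (some e) * k e F = 0 := fun F => by
      have := congrFun hm F
      simpa [Fintype.sum_option] using this
    have hsome : ∀ e, m (some e) = 0 := by
      refine PlaneGraph.eq_zero_of_sum_log_jump (A := fun e : ι => D.arc e.1)
        (C := -m none) (n := fun e => m (some e)) (fun e => (D.isCompact_arc e.1).isClosed)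
        (D.isClosed_partialSupport T) (fun e => D.point_injective.ne (hadj e).ne) ?_ ?_ ha hb
        hexpa hexpb ?_
      · rintro e z ⟨hz, ⟨w, rfl⟩ | hz'⟩
        · exact hend e w (D.mem_of_point_mem_arc _ _ hz)
        · obtain ⟨e', he'⟩ := mem_iUnion.1 hz'
          exact hmeet e e'.1 (fun h => e.2 (h ▸ e'.2)) ⟨hz, he'⟩
      · exact fun e e' hne => hmeet e e'.1 fun h => hne (Subtype.ext h)
      · intro z hz
        rw [← hcompl] at hz
        let F : D.faces := ⟨connectedComponentIn D.supportᶜ z, z, hz, rfl⟩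
        rw [Finset.sum_congr rfl fun e _ => by
          rw [hconst e F z (mem_connectedComponentIn hz)], ← eq_neg_of_add_eq_zero_right (hm' F)]
        push_cast
        rw [Finset.mul_sum]
        exact Finset.sum_congr rfl fun e _ => by ring
    rintro (_ | e)
    -- The support is compact, hence not the plane, so some face exists on which the constant term
    -- can be evaluated.
    · obtain ⟨z, hz⟩ : D.supportᶜ.Nonempty := by
        by_contra h
        rw [not_nonempty_iff_eq_empty, compl_empty_iff] at h
        exact D.isCompact_support.ne_univ h
      have := hm' ⟨connectedComponentIn D.supportᶜ z, z, hz, rfl⟩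
      simpa [hsome] using this
    · exact hsome e
  have hcard := hlin.fintype_card_le_finrank
  rw [Module.finrank_fintype_fun_eq_card, Fintype.card_option] at hcard
  have hsplit : Fintype.card G.edgeSet
      = Fintype.card {e : G.edgeSet // (e : Sym2 V) ∈ T.edgeSet} + Fintype.card ι := by
    rw [Fintype.card_subtype_compl]
    have := Fintype.card_subtype_le fun e : G.edgeSet => (e : Sym2 V) ∈ T.edgeSet
    omega
  have htree : Fintype.card {e : G.edgeSet // (e : Sym2 V) ∈ T.edgeSet} + 1
      = Fintype.card V := by
    rw [← hT.card_edgeFinset, ← SimpleGraph.card_edgeSet]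
    congr 1
    exact Fintype.card_congr (Equiv.subtypeSubtypeEquivSubtype
      fun {e} he => SimpleGraph.edgeSet_mono hTG he)
  rw [Nat.card_eq_fintype_card, Nat.card_eq_fintype_card, Set.ncard_eq_toFinset_card',
    Set.toFinset_card]
  omega

end PlaneDrawing

/-! ### Counting corners of triangular faces -/

namespace PlaneDrawing

variable {V : Type*} {G : SimpleGraph V} (D : PlaneDrawing G)

/-- Forgetting the cyclic order makes all corners alike: the corner at a vertex of S is given by the
other two elements of S. -/
theorem exists_card_eq_three_of_boundedByTriangle {F : Set ℂ} (hF : D.BoundedByTriangle F) :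
    ∃ S : Finset V, S.card = 3 ∧ ∀ x ∈ S, ∀ y ∈ S, x ≠ y →
      ∃ h : G.Adj x y, D.OnBoundary ⟨s(x, y), h⟩ F := by
  classical
  obtain ⟨u, v, w, huv, hvw, hwu, hfr⟩ := hF
  have hb1 : D.arc ⟨s(u, v), huv⟩ ⊆ frontier F := fun z hz => hfr ▸ Or.inl (Or.inl hz)
  have hb2 : D.arc ⟨s(v, w), hvw⟩ ⊆ frontier F := fun z hz => hfr ▸ Or.inl (Or.inr hz)
  have hb3 : D.arc ⟨s(w, u), hwu⟩ ⊆ frontier F := fun z hz => hfr ▸ Or.inr hz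
  have hswap : ∀ {x y : V} (h : G.Adj x y), D.arc ⟨s(x, y), h⟩ ⊆ frontier F →
      D.arc ⟨s(y, x), h.symm⟩ ⊆ frontier F := by
    intro x y h hxy
    rwa [show (⟨s(y, x), h.symm⟩ : G.edgeSet) = ⟨s(x, y), h⟩ from Subtype.ext Sym2.eq_swap]
  refine ⟨{u, v, w}, Finset.card_eq_three.2 ⟨u, v, w, huv.ne, hwu.ne', hvw.ne, rfl⟩, ?_⟩
  intro x hx y hy hxy
  simp only [Finset.mem_insert, Finset.mem_singleton] at hx hy
  rcases hx with rfl | rfl | rfl <;> rcases hy with rfl | rfl | rfl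
  exacts [absurd rfl hxy, ⟨_, hb1⟩, ⟨_, hswap _ hb3⟩, ⟨_, hswap _ hb1⟩, absurd rfl hxy,
    ⟨_, hb2⟩, ⟨_, hb3⟩, ⟨_, hswap _ hb2⟩, absurd rfl hxy]

/-- Double counting of the corners of triangular faces. -/
theorem three_mul_ncard_triangularFaces_add_le [Fintype V] [DecidableRel G.Adj]
    (hdeg : 3 ≤ G.minDegree)
    (hshare : ∀ F ∈ D.triangularFaces, ∀ F' ∈ D.triangularFaces, F ≠ F' →
      ∀ e : G.edgeSet, ¬ (D.OnBoundary e F ∧ D.OnBoundary e F')) :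
    3 * D.triangularFaces.ncard + 2 * Nat.card V ≤ 2 * Nat.card G.edgeSet := by
  classical
  have : Fintype D.triangularFaces :=
    ((finite_faces D).subset fun F (hF : F ∈ D.triangularFaces) => hF.1).fintype
  choose S hScard hS using fun F : D.triangularFaces =>
    D.exists_card_eq_three_of_boundedByTriangle F.2.2
  -- The triangular faces at v take disjoint pairs of neighbours, since a common neighbour would
  -- give a shared edge. So t of them force degree at least 2t, which settles t ≥ 2; for t ≤ 1 the
  -- minimum degree 3 suffices.
  have hcorner : ∀ v : V, (Finset.univ.filter fun F => v ∈ S F).card + 2 ≤ G.degree v := by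
    intro v
    have hle : ((Finset.univ.filter fun F => v ∈ S F).biUnion fun F => (S F).erase v).card
        ≤ G.degree v := by
      refine Finset.card_le_card fun x hx => ?_
      obtain ⟨F, hF, hxF⟩ := Finset.mem_biUnion.1 hx
      obtain ⟨h, -⟩ := hS F v (Finset.mem_filter.1 hF).2 x (Finset.mem_of_mem_erase hxF)
        (Finset.ne_of_mem_erase hxF).symm
      exact (G.mem_neighborFinset v x).2 h
    rw [Finset.card_biUnion, Finset.sum_congr rfl fun F hF => by
      rw [Finset.card_erase_of_mem (Finset.mem_filter.1 hF).2, hScard], Finset.sum_const,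
      smul_eq_mul] at hle
    · have := hdeg.trans (G.minDegree_le_degree v)
      omega
    · intro F hF F' hF' hne
      refine Finset.disjoint_left.2 fun x hx hx' => ?_
      have hvx := (Finset.ne_of_mem_erase hx).symm
      obtain ⟨h, hb⟩ := hS F v (Finset.mem_filter.1 hF).2 x (Finset.mem_of_mem_erase hx) hvx
      obtain ⟨_, hb'⟩ := hS F' v (Finset.mem_filter.1 hF').2 x (Finset.mem_of_mem_erase hx') hvx
      exact hshare F F.2 F' F'.2 (fun h => hne (Subtype.ext h)) _ ⟨hb, hb'⟩
  have hdouble : ∑ v : V, (Finset.univ.filter fun F => v ∈ S F).card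
      = 3 * Fintype.card D.triangularFaces := by
    have h := Finset.sum_card_bipartiteAbove_eq_sum_card_bipartiteBelow
      (s := (Finset.univ : Finset V)) (t := (Finset.univ : Finset D.triangularFaces))
      (fun v F => v ∈ S F)
    simp only [Finset.bipartiteAbove, Finset.bipartiteBelow, Finset.filter_univ_mem, hScard,
      Finset.sum_const, Finset.card_univ, smul_eq_mul] at h
    rw [h, mul_comm]
  have hsum := Finset.sum_le_sum fun v (_ : v ∈ Finset.univ) => hcorner v
  rw [Finset.sum_add_distrib, hdouble, G.sum_degrees_eq_twice_card_edges, Finset.sum_const,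
    smul_eq_mul, Finset.card_univ] at hsum
  rw [Set.ncard_eq_toFinset_card', Set.toFinset_card, Nat.card_eq_fintype_card,
    Nat.card_eq_fintype_card, SimpleGraph.card_edgeSet]
  omega

end PlaneDrawing

theorem mainTheorem1 {V : Type*} [Fintype V] (G : SimpleGraph V) [DecidableRel G.Adj]
    (D : PlaneDrawing G) (hconn : G.Connected) (hdeg : 3 ≤ G.minDegree)
    (hshare : ∀ F ∈ D.triangularFaces, ∀ F' ∈ D.triangularFaces, F ≠ F' →
      ∀ e : G.edgeSet, ¬ (D.OnBoundary e F ∧ D.OnBoundary e F')) :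
    D.faces.Finite ∧
      (D.triangularFaces.ncard : ℝ) ≤ (2 * (D.faces.ncard : ℝ) - 4) / 3 ∧
      (D.triangularFaces.ncard : ℝ) < 2 / 3 * (D.faces.ncard : ℝ) := by
  have h1 := D.card_edgeSet_add_two_le hconn
  have h2 := D.three_mul_ncard_triangularFaces_add_le hdeg hshare
  have h3 : 3 * D.triangularFaces.ncard + 4 ≤ 2 * D.faces.ncard := by omega
  have h4 : 3 * (D.triangularFaces.ncard : ℝ) + 4 ≤ 2 * (D.faces.ncard : ℝ) := by
    exact_mod_cast h3
  exact ⟨PlaneDrawing.finite_faces D, by linarith, by linarith⟩
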